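/- A Boolean function is a map $f\colon\{0,1\}^n\to\{0,1\}$ with $n\ge 1$; its true points are the elements of $f^{-1}(1)$. For classes $C,K$ of Boolean functions let $CK$ be the set of all compositions $f(g_1,\dots,g_n)$ with $f\in C$ $n$-ary and $g_1,\dots,g_n\in K$ of a common arity. A clone is a class $C$ that contains all projections and satisfies $CC\subseteq C$. Order $\{0,1\}$ by $0<1$ and $\{0,1\}^n$ componentwise, write $\mathbf 0,\mathbf 1$ for the constant tuples and $\overline{\mathbf a}$ for the complement of $\mathbf a$. Let $T_{ab}$ be the class of all $f$ with $f(\mathbf 0)=a$ and $f(\mathbf 1)=b$; let $T_{*1}$ and $T_{1*}$ be the classes of all $f$ with $f(\mathbf 1)=1$, respectively $f(\mathbf 0)=1$; let $C_0$ be the class of constant $0$ functions, $M$ the class of monotone functions, $M_0$, $M_1$, $M_{01}$ the classes of monotone functions with $f(\mathbf 0)=0$, with $f(\mathbf 1)=1$, and with both; $\overline{K}$ the class of the negations $\overline f\colon \mathbf a\mapsto 1-f(\mathbf a)$ of the members $f$ of $K$; $R$ the class of all $f$ with $f(\mathbf a)=f(\overline{\mathbf a})$ for all $\mathbf a$, and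 $R_{00}=R\cap T_{00}$. For $k\in\{2,3,\dots\}\cup\{\infty\}$ let $U^k$ be the class of all $f$ such that $\bigwedge T\ne\mathbf 0$ for every $T\subseteq f^{-1}(1)$ with $|T|\le k$; let $MU^k=M\cap U^k$, $T_{01}U^k=T_{01}\cap U^k$ and $MU^k_{01}=M_{01}\cap U^k$. For $\ell\in\mathbb N\cup\{\infty\}$ let $\Omega^{[\le \ell]}$ be the class of functions with at most $\ell$ true points. For a class $\Theta$ of Boolean functions let $U^\ell(\Theta)$ be the class of all $f$, of any arity $n$, such that for every $T\subseteq f^{-1}(1)$ with $|T|\le \ell$ there are $\theta\in\Theta$, of some arity $h$, and $\tau\colon\{1,\dots,h\}\to\{1,\dots,n\}$ with $\theta(a_{\tau(1)},\dots,a_{\tau(h)})=1$ for all $\mathbf a\in T$. For $D\in\{T_{*1},T_{1*},M,\overline M,R\}$ let $f^D$ be the least function $g\ge f$ of the same arity that lies in $D$; $\Theta$ is called $(k,D)$-closed if for all $\varphi\in\Theta$ and all $T\subseteq(\varphi^D)^{-1}(1)$ with $|T|\le k$ the characteristic function $\chi_T$ lies in $\Theta$. **Proposition.** Let $k\in\mathbb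 N\cup\{\infty\}$ with $k\ge 2$, and let $\emptyset\ne\Theta\subseteq\Omega^{[\le k]}$. Assume that $k$ is the least $\ell\in\mathbb N\cup\{\infty\}$ such that $U^k(\Theta)=U^\ell(\Theta')$ for some $\Theta'\subseteq\Omega^{[\le \ell]}$. Let $C$ be a clone of Boolean functions. 1. $C\,U^k(\Theta)\subseteq U^k(\Theta)$ if and only if $C\subseteq U^k$. 2. If $\Theta$ is $(k,T_{*1})$-closed, then, for $K=U^k(\Theta)\cap(T_{01}\cup C_0)$, $CK\subseteq K$ if and only if $C\subseteq MU^k$; and, for $K=U^k(\Theta)\cap T_{01}$, $CK\subseteq K$ if and only if $C\subseteq T_{01}U^k$. 3. If $\Theta$ is $(k,T_{1*})$-closed, then, for $K=U^k(\Theta)\cap(T_{10}\cup C_0)$, $CK\subseteq K$ if and only if $C\subseteq MU^k$; and, for $K=U^k(\Theta)\cap T_{10}$, $CK\subseteq K$ if and only if $C\subseteq T_{01}U^k$. 4. If $\Theta$ is $(k,M)$-closed, then, for $K=U^k(\Theta)\cap M_0$, $CK\subseteq K$ if and only if $C\subseteq MU^k$; and, for $K=U^k(\Theta)\cap M_{01}$,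 $CK\subseteq K$ if and only if $C\subseteq MU^k_{01}$. 5. If $\Theta$ is $(k,\overline M)$-closed, then, for $K=U^k(\Theta)\cap\overline{M_1}$, $CK\subseteq K$ if and only if $C\subseteq MU^k$; and, for $K=U^k(\Theta)\cap\overline{M_{01}}$, $CK\subseteq K$ if and only if $C\subseteq MU^k_{01}$. 6. If $\Theta$ is $(k,R)$-closed, then, for $K=U^k(\Theta)\cap R_{00}$, $CK\subseteq K$ if and only if $C\subseteq U^k$. -/

import Mathlib

namespace BoolClonoid

/-- `n`-ary Boolean functions. -/
abbrev BFun (n : ℕ) : Type := (Fin n → Bool) → Bool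

/-- Boolean functions of several arguments. Every arity is positive, as usual for clones, and as
in the composition of function classes below. -/
abbrev BF : Type := Σ n : ℕ+, BFun n

/-! ### Composition of function classes, clones -/

/-- The composition `C K` of function classes: all `f(g₁, …, gₙ)` with an `n`-ary `f` in `C` and
`m`-ary `g₁, …, gₙ` in `K`. -/
def comp (C K : Set BF) : Set BF :=
  {h | ∃ (m n : ℕ+) (f : BFun n) (g : Fin n → BFun m),
    (⟨n, f⟩ : BF) ∈ C ∧ (∀ i, (⟨m, g i⟩ : BF) ∈ K) ∧ h = ⟨m, fun a => f (fun i => g i a)⟩}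

/-- The class of all projections. -/
def Proj : Set BF := {h | ∃ (n : ℕ+) (i : Fin n), h = ⟨n, fun a => a i⟩}

/-- A clone of Boolean functions. -/
structure IsClone (C : Set BF) : Prop where
  proj_subset : Proj ⊆ C
  comp_subset : comp C C ⊆ C

/-! ### Classes of Boolean functions

The order on `Bool` is `false < true`, tuples are ordered componentwise; `⊥` and `⊤` are the
constant tuples `0` and `1`, and `aᶜ` is the componentwise complement of `a`. -/

/-- `f(0) = 0`. -/
def T0X : Set BF := {f | f.2 ⊥ = false}

/-- `f(0) = 1`. -/
def T1X : Set BF := {f | f.2 ⊥ = true}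

/-- `f(1) = 0`. -/
def TX0 : Set BF := {f | f.2 ⊤ = false}

/-- `f(1) = 1`. -/
def TX1 : Set BF := {f | f.2 ⊤ = true}

/-- `f(0) = 0` and `f(1) = 1`. -/
def T01 : Set BF := T0X ∩ TX1

/-- `f(0) = 1` and `f(1) = 0`. -/
def T10 : Set BF := T1X ∩ TX0

/-- The constant `0` functions. -/
def C0 : Set BF := {f | ∀ a, f.2 a = false}

/-- The monotone functions. -/
def M : Set BF := {f | Monotone f.2}

/-- The monotone functions with `f(0) = 0`. -/
def M0 : Set BF := M ∩ T0X

/-- The monotone functions with `f(1) = 1`. -/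
def M1 : Set BF := M ∩ TX1

/-- The monotone functions with `f(0) = 0` and `f(1) = 1`. -/
def M01 : Set BF := M ∩ T01

/-- The class of the (outer) negations of the members of a class. -/
def negClass (C : Set BF) : Set BF := {h | ∃ f ∈ C, h = ⟨f.1, fun a => !(f.2 a)⟩}

/-- The reflexive functions: `f(a) = f(aᶜ)` for all `a`. -/
def R : Set BF := {f | ∀ a, f.2 a = f.2 aᶜ}

/-- The reflexive functions with `f(0) = f(1) = 0`. -/
def R00 : Set BF := R ∩ (T0X ∩ TX0)

/-- The `1`-separating functions of rank `k`: no set of at most `k` true points has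
meet `(0, …, 0)`. -/
def U (k : ℕ∞) : Set BF :=
  {f | ∀ T : Finset (Fin f.1 → Bool),
    (∀ a ∈ T, f.2 a = true) → (T.card : ℕ∞) ≤ k → T.inf id ≠ ⊥}

/-- `M ∩ U k`. -/
def MU (k : ℕ∞) : Set BF := M ∩ U k

/-- `T01 ∩ U k`. -/
def T01U (k : ℕ∞) : Set BF := T01 ∩ U k

/-- `M01 ∩ U k`. -/
def M01U (k : ℕ∞) : Set BF := M01 ∩ U k

/-! ### The classes `Uₖ(Θ)` -/

/-- The characteristic function of a set of `n`-tuples. -/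
def chi {n : ℕ} (T : Finset (Fin n → Bool)) : BFun n := fun a => decide (a ∈ T)

/-- The functions with at most `l` true points. -/
def AtMost (l : ℕ∞) : Set BF := {f | ((Finset.univ.filter fun a => f.2 a = true).card : ℕ∞) ≤ l}

/-- Some minor of a member of `Θ` takes the value `1` on all of `T`. -/
def Dominated {n : ℕ} (T : Finset (Fin n → Bool)) (Θ : Set BF) : Prop :=
  ∃ θ ∈ Θ, ∃ τ : Fin θ.1 → Fin n, ∀ a ∈ T, θ.2 (a ∘ τ) = true

/-- The class `Uₗ(Θ)`. -/
def UTheta (l : ℕ∞) (Θ : Set BF) : Set BF :=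
  {f | ∀ T : Finset (Fin f.1 → Bool),
    (∀ a ∈ T, f.2 a = true) → (T.card : ℕ∞) ≤ l → Dominated T Θ}

/-- `k` is the least `l` such that `Uₖ(Θ) = Uₗ(Θ')` for some set `Θ'` of functions with at most
`l` true points. -/
def IsMinimalRank (k : ℕ∞) (Θ : Set BF) : Prop :=
  IsLeast {l : ℕ∞ | ∃ Θ' : Set BF, Θ' ⊆ AtMost l ∧ UTheta k Θ = UTheta l Θ'} k

/-! ### `C`-closures -/

/-- The majorants of `f` that lie in `C`. -/
def majorants (C : Set BF) {n : ℕ+} (f : BFun n) : Set (BFun n) :=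
  {g | f ≤ g ∧ (⟨n, g⟩ : BF) ∈ C}

/-- The `C`-closure of `f`, the least majorant of `f` in `C` (the lemmas below show that it
is one, and describe it, for the five classes for which it is used). -/
noncomputable def cl (C : Set BF) {n : ℕ+} (f : BFun n) : BFun n := sInf (majorants C f)

/-- `Φ` is `(k, C)`-closed. -/
def IsKClosed (k : ℕ∞) (C Φ : Set BF) : Prop :=
  ∀ φ ∈ Φ, ∀ T : Finset (Fin φ.1 → Bool),
    (∀ a ∈ T, cl C φ.2 a = true) → (T.card : ℕ∞) ≤ k → (⟨φ.1, chi T⟩ : BF) ∈ Φ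

theorem cl_eq_of_isLeast {C : Set BF} {n : ℕ+} {f g : BFun n} (h : IsLeast (majorants C f) g) :
    cl C f = g := h.isGLB.sInf_eq

theorem bool_le_of_imp {x y : Bool} (h : x = true → y = true) : x ≤ y := by
  cases x <;> cases y <;> simp_all

theorem bool_eq_true_of_le {x y : Bool} (h : x = true) (hxy : x ≤ y) : y = true := by
  subst h
  exact top_le_iff.1 hxy

theorem bool_not_le_not {x y : Bool} (h : x ≤ y) : (!y) ≤ (!x) := by
  revert h; cases x <;> cases y <;> simp

theorem mem_negClass_M {n : ℕ+} {f : BFun n} : (⟨n, f⟩ : BF) ∈ negClass M ↔ Antitone f := by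
  constructor
  · rintro ⟨⟨m, g⟩, hg, h⟩
    cases h
    exact fun a b hab => bool_not_le_not (hg hab)
  · intro h
    exact ⟨⟨n, fun a => !(f a)⟩, fun a b hab => bool_not_le_not (h hab), by simp⟩

theorem isLeast_TX1 {n : ℕ+} (f : BFun n) :
    IsLeast (majorants TX1 f) (fun a => f a || decide (a = ⊤)) := by
  refine ⟨⟨fun a => bool_le_of_imp fun h => by simp [h], by simp [TX1]⟩, ?_⟩
  rintro g ⟨hfg, hg⟩ a
  refine bool_le_of_imp fun h => ?_
  rcases Bool.or_eq_true _ _ ▸ h with h | h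
  · exact bool_eq_true_of_le h (hfg a)
  · rw [of_decide_eq_true h]; exact hg

theorem isLeast_T1X {n : ℕ+} (f : BFun n) :
    IsLeast (majorants T1X f) (fun a => f a || decide (a = ⊥)) := by
  refine ⟨⟨fun a => bool_le_of_imp fun h => by simp [h], by simp [T1X]⟩, ?_⟩
  rintro g ⟨hfg, hg⟩ a
  refine bool_le_of_imp fun h => ?_
  rcases Bool.or_eq_true _ _ ▸ h with h | h
  · exact bool_eq_true_of_le h (hfg a)
  · rw [of_decide_eq_true h]; exact hg

open Classical in
theorem isLeast_M {n : ℕ+} (f : BFun n) :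
    IsLeast (majorants M f) (fun a => decide (∃ b, b ≤ a ∧ f b = true)) := by
  refine ⟨⟨fun a => bool_le_of_imp fun h => decide_eq_true ⟨a, le_rfl, h⟩, ?_⟩, ?_⟩
  · intro a b hab
    refine bool_le_of_imp fun h => ?_
    obtain ⟨c, hc, hf⟩ := of_decide_eq_true h
    exact decide_eq_true ⟨c, hc.trans hab, hf⟩
  · rintro g ⟨hfg, hg⟩ a
    refine bool_le_of_imp fun h => ?_
    obtain ⟨c, hc, hf⟩ := of_decide_eq_true h
    exact bool_eq_true_of_le hf ((hfg c).trans (hg hc))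

open Classical in
theorem isLeast_negM {n : ℕ+} (f : BFun n) :
    IsLeast (majorants (negClass M) f) (fun a => decide (∃ b, a ≤ b ∧ f b = true)) := by
  refine ⟨⟨fun a => bool_le_of_imp fun h => decide_eq_true ⟨a, le_rfl, h⟩, ?_⟩, ?_⟩
  · refine mem_negClass_M.2 fun a b hab => ?_
    refine bool_le_of_imp fun h => ?_
    obtain ⟨c, hc, hf⟩ := of_decide_eq_true h
    exact decide_eq_true ⟨c, hab.trans hc, hf⟩
  · rintro g ⟨hfg, hg⟩ a
    refine bool_le_of_imp fun h => ?_
    obtain ⟨c, hc, hf⟩ := of_decide_eq_true h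
    exact bool_eq_true_of_le hf ((hfg c).trans (mem_negClass_M.1 hg hc))

theorem isLeast_R {n : ℕ+} (f : BFun n) :
    IsLeast (majorants R f) (fun a => f a || f aᶜ) := by
  refine ⟨⟨fun a => bool_le_of_imp fun h => by simp [h], fun a => ?_⟩, ?_⟩
  · simp only [compl_compl]
    exact Bool.or_comm _ _
  · rintro g ⟨hfg, hg⟩ a
    refine bool_le_of_imp fun h => ?_
    rcases Bool.or_eq_true _ _ ▸ h with h | h
    · exact bool_eq_true_of_le h (hfg a)
    · have : g a = g aᶜ := hg a
      rw [this]
      exact bool_eq_true_of_le h (hfg aᶜ)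

end BoolClonoid

open BoolClonoid

namespace BoolClonoid

/-! That `U k` suffices for stability of `Uₖ(Θ)` is direct: if `f(g₁, …, gₘ)` is `1` on a set `T` of
at most `k` tuples, the tuples `(g₁(a), …, gₘ(a))` with `a ∈ T` are at most `k` true points of `f`,
hence share a coordinate `i` with value `1`. So `gᵢ` is `1` on `T`, and `T` is dominated
(`comp_UTheta_subset`).

For the converse, minimality of `k` yields critical sets, minimal non-dominated ones, of at most `k`
elements and of every size threshold up to `k` (`exists_isCritical`). If some `f ∈ C` has a set `T₀`
of at most `k` true points with meet `0`, map a critical `T` onto `T₀`. Each coordinate of `T₀` then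
pulls back to a proper subset of `T`, which is dominated and so is the trace on `T` of some `gᵢ`.
The composition `f(g₁, …, gₘ)` is `1` on `T`, so it is not in `Uₖ(Θ)`.

For the smaller classes `K` the `gᵢ` must also lie in `K`. Closures of characteristic functions
provide them: by `(k, D)`-closedness the closure stays in `Uₖ(Θ)` (`cl_mem_UTheta`), and by
criticality it acquires no new point of `T` (`cl_chi_iff`). The remaining conditions on `C`,
monotonicity and preservation of constants, come from evaluating compositions with small explicit
functions. A parameter `c : Bool` treats each class together with its dual under negated inputs. -/

/-! ### Separation, domination and membership in `Uₖ(Θ)` -/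

theorem inf_ne_bot_iff {n : ℕ} {T : Finset (Fin n → Bool)} :
    T.inf id ≠ ⊥ ↔ ∃ i, ∀ a ∈ T, a i = true := by
  rw [Ne, funext_iff, not_forall]
  refine exists_congr fun i => ?_
  rw [Finset.inf_apply]
  constructor
  · intro h a ha
    have hle : (T.inf fun b => b i) ≤ a i := Finset.inf_le (f := fun b => b i) ha
    refine bool_eq_true_of_le ?_ hle
    cases h' : T.inf fun b => b i
    · exact absurd h' h
    · rfl
  · intro h h'
    have : (⊤ : Bool) ≤ T.inf fun b => b i := Finset.le_inf fun a ha => (h a ha).ge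
    exact absurd (this.trans h'.le) (show ¬ (⊤ : Bool) ≤ ⊥ by decide)

theorem apply_bot_of_mem_U {k : ℕ∞} (hk : 2 ≤ k) {f : BF} (hf : f ∈ U k) : f.2 ⊥ = false := by
  by_contra h
  have := hf {⊥} (by simpa using h) (by simpa using le_trans (by norm_num) hk)
  simp at this

theorem Dominated.mono {n : ℕ} {S T : Finset (Fin n → Bool)} {Θ : Set BF} (hST : S ⊆ T)
    (h : Dominated T Θ) : Dominated S Θ := by
  obtain ⟨θ, hθ, τ, hτ⟩ := h
  exact ⟨θ, hθ, τ, fun a ha => hτ a (hST ha)⟩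

theorem mem_UTheta_of_le {k : ℕ∞} {Θ : Set BF} {n : ℕ+} {f g : BFun n}
    (hg : (⟨n, g⟩ : BF) ∈ UTheta k Θ) (h : ∀ a, f a = true → g a = true) :
    (⟨n, f⟩ : BF) ∈ UTheta k Θ :=
  fun T hT hc => hg T (fun a ha => h a (hT a ha)) hc

theorem chi_eq_true {n : ℕ} {T : Finset (Fin n → Bool)} {a : Fin n → Bool} :
    chi T a = true ↔ a ∈ T := by
  simp [chi]

theorem chi_mem_UTheta {k : ℕ∞} {Θ : Set BF} {n : ℕ+} {T : Finset (Fin n → Bool)}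
    (h : Dominated T Θ) : (⟨n, chi T⟩ : BF) ∈ UTheta k Θ :=
  fun _ hS _ => h.mono fun a ha => chi_eq_true.1 (hS a ha)

/-- A function that is `1` on both constant tuples can only lie in a class `Uₖ(Θ)` that contains
all functions. -/
theorem dominated_of_apply_bot_top {k : ℕ∞} (hk : 2 ≤ k) {Θ : Set BF} {n : ℕ+} {f : BFun n}
    (hf : (⟨n, f⟩ : BF) ∈ UTheta k Θ) (h0 : f ⊥ = true) (h1 : f ⊤ = true)
    {m : ℕ+} (T : Finset (Fin m → Bool)) : Dominated T Θ := by
  obtain ⟨θ, hθ, τ, hτ⟩ := hf {⊥, ⊤} (by simp [h0, h1])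
    (le_trans (by exact_mod_cast Finset.card_le_two) hk)
  -- Identifying all variables of `θ` turns every tuple into a constant one, and `θ` is `1` at both
  -- constants.
  refine ⟨θ, hθ, fun _ => ⟨0, m.pos⟩, fun a _ => ?_⟩
  cases h : a ⟨0, m.pos⟩
  · convert hτ ⊥ (by simp) using 2
    funext i
    exact h
  · convert hτ ⊤ (by simp) using 2
    funext i
    exact h

/-- If some member of `Uₖ(Θ)` is `1` on a constant tuple, then every (negated) projection lies in
`Uₖ(Θ)`, and so does every function below it. -/
theorem mem_UTheta_of_le_proj {k : ℕ∞} (hk : 2 ≤ k) {Θ : Set BF} {n : ℕ+} {f : BFun n} {c : Bool}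
    (hf : (⟨n, f⟩ : BF) ∈ UTheta k Θ) (hc : f (fun _ => c) = true) {m : ℕ+} {g : BFun m}
    (i : Fin m) (hg : ∀ a, g a = true → a i = c) : (⟨m, g⟩ : BF) ∈ UTheta k Θ := by
  intro T hT _
  obtain ⟨θ, hθ, τ, hτ⟩ := hf {fun _ => c} (by simpa using hc)
    (by simpa using le_trans (by norm_num) hk)
  refine ⟨θ, hθ, fun _ => i, fun a ha => ?_⟩
  convert hτ (fun _ => c) (by simp) using 2
  funext j
  exact hg a (hT a ha)

/-! ### Critical sets -/

/-- A minimal set that is not dominated by `Θ`. -/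
structure IsCritical (Θ : Set BF) {n : ℕ} (T : Finset (Fin n → Bool)) : Prop where
  not_dominated : ¬ Dominated T Θ
  dominated_of_ssubset : ∀ S, S ⊂ T → Dominated S Θ

/-- If all non-dominated sets of at most `k` true points contained small non-dominated ones,
restrictions of members of `Θ` to `l` points would define the same class, against the minimality of
`k`. For `k = ∞` this gives finite critical sets of unbounded size. -/
theorem exists_isCritical {k : ℕ∞} {Θ : Set BF} (hmin : IsMinimalRank k Θ) (l : ℕ)
    (hlk : (l : ℕ∞) + 1 ≤ k) :
    ∃ (n : ℕ+) (T : Finset (Fin n → Bool)), l < T.card ∧ (T.card : ℕ∞) ≤ k ∧ IsCritical Θ T := by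
  classical
  -- All restrictions of members of `Θ` to at most `l` of their true points.
  set Θ' : Set BF := {f | ∃ φ ∈ Θ, ∃ T : Finset (Fin φ.1 → Bool),
    (∀ a ∈ T, φ.2 a = true) ∧ T.card ≤ l ∧ f = ⟨φ.1, chi T⟩} with hΘ'
  have hlt : (l : ℕ∞) < k := (ENat.add_one_le_iff (ENat.natCast_ne_top l)).1 hlk
  have hat : Θ' ⊆ AtMost l := by
    rintro f ⟨φ, -, T, -, hT, rfl⟩
    simpa [AtMost, chi] using hT
  have hne : UTheta k Θ ≠ UTheta l Θ' := fun h => absurd (hmin.2 ⟨Θ', hat, h⟩) hlt.not_ge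
  have hsub : UTheta k Θ ⊆ UTheta l Θ' := by
    intro f hf T hT hc
    obtain ⟨θ, hθ, τ, hτ⟩ := hf T hT (hc.trans hlt.le)
    refine ⟨⟨θ.1, chi (T.image (· ∘ τ))⟩, ⟨θ, hθ, T.image (· ∘ τ), ?_, ?_, rfl⟩, τ, fun a ha => ?_⟩
    · simpa using hτ
    · exact Finset.card_image_le.trans (by exact_mod_cast hc)
    · exact chi_eq_true.2 (Finset.mem_image_of_mem _ ha)
  obtain ⟨f, hf, hfk⟩ : ∃ f ∈ UTheta l Θ', f ∉ UTheta k Θ := by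
    by_contra! h
    exact hne (hsub.antisymm h)
  obtain ⟨T₁, hT₁, hc₁, hd₁⟩ : ∃ T : Finset (Fin f.1 → Bool), (∀ a ∈ T, f.2 a = true) ∧
      (T.card : ℕ∞) ≤ k ∧ ¬ Dominated T Θ := by
    simpa [UTheta] using hfk
  obtain ⟨T, hTT, hT⟩ := exists_minimal_le_of_wellFoundedLT
    (fun S : Finset (Fin f.1 → Bool) => ¬ Dominated S Θ) T₁ hd₁
  refine ⟨f.1, T, ?_, le_trans (by exact_mod_cast Finset.card_le_card hTT) hc₁, hT.prop,
    fun S hS => by_contra fun h => hT.not_prop_of_lt hS h⟩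
  -- A set `T` of at most `l` true points of `f` is dominated by `Θ'`, whose members lie below
  -- members of `Θ`.
  by_contra! hcard
  obtain ⟨_, ⟨φ, hφ, S, hS, -, rfl⟩, τ, hτ⟩ :=
    hf T (fun a ha => hT₁ a (hTT ha)) (by exact_mod_cast hcard)
  exact hT.prop ⟨φ, hφ, τ, fun a ha => hS _ (chi_eq_true.1 (hτ a ha))⟩

/-- If every proper subset of a critical set is the trace of a function in `K`, then only
`1`-separating functions can stabilize `K` on the left. -/
theorem subset_U_of_comp_subset {k : ℕ∞} (hk : 2 ≤ k) {Θ K C : Set BF}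
    (hmin : IsMinimalRank k Θ)
    (hK : ∀ (n : ℕ+) (T : Finset (Fin n → Bool)), 1 < T.card → (T.card : ℕ∞) ≤ k →
      IsCritical Θ T → ∀ S, S ⊂ T →
      ∃ g : BFun n, (⟨n, g⟩ : BF) ∈ K ∧ ∀ a ∈ T, (g a = true ↔ a ∈ S))
    (hCK : comp C K ⊆ UTheta k Θ) : C ⊆ U k := by
  classical
  rintro ⟨m, f⟩ hf T₀ hT₀ hc₀ hinf
  have hzero : ∀ i, ∃ t ∈ T₀, t i = false := by
    have := (not_congr inf_ne_bot_iff).1 (not_not.2 hinf)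
    simpa using this
  have hne₀ : T₀.Nonempty := (hzero ⟨0, m.pos⟩).imp fun t ht => ht.1
  -- The bound makes `T` large enough to map onto `T₀` and ensures at least two elements, as `hK`
  -- demands.
  obtain ⟨n, T, hlT, hTk, hT⟩ := exists_isCritical hmin (max T₀.card 2 - 1) (by
    have : max T₀.card 2 - 1 + 1 = max T₀.card 2 := by omega
    rw [← Nat.cast_succ, Nat.succ_eq_add_one, this]
    rcases max_choice T₀.card 2 with h | h <;> rw [h]
    exacts [hc₀, hk])
  obtain ⟨e⟩ : Nonempty (T₀ ↪ T) :=
    Function.Embedding.nonempty_of_card_le (by simp only [Fintype.card_coe]; omega)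
  obtain ⟨t₀, ht₀⟩ := hne₀
  have : Nonempty T₀ := ⟨⟨t₀, ht₀⟩⟩
  set σ : (Fin n → Bool) → (Fin m → Bool) := fun a =>
    if h : a ∈ T then (Function.invFun e ⟨a, h⟩ : T₀) else t₀ with hσ
  have hσT : ∀ a, σ a ∈ T₀ := by
    intro a
    simp only [hσ]
    split_ifs
    · exact Subtype.coe_prop _
    · exact ht₀
  have hsurj : ∀ t ∈ T₀, ∃ a ∈ T, σ a = t := by
    intro t ht
    refine ⟨e ⟨t, ht⟩, (e ⟨t, ht⟩).2, ?_⟩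
    simp only [hσ, Finset.coe_mem, dif_pos, Subtype.coe_eta]
    rw [Function.leftInverse_invFun e.injective]
  -- The meet of `T₀` is `0`, so each coordinate vanishes at some `t ∈ T₀`, and a preimage of `t` is
  -- left out.
  have hS : ∀ i, T.filter (fun a => σ a i = true) ⊂ T := by
    intro i
    obtain ⟨t, ht, hti⟩ := hzero i
    obtain ⟨a, ha, rfl⟩ := hsurj t ht
    exact Finset.filter_ssubset.2 ⟨a, ha, by simp [hti]⟩
  choose g hgK hg using fun i => hK n T (by omega) hTk hT _ (hS i)
  refine hT.not_dominated (hCK ⟨n, m, f, g, hf, hgK, rfl⟩ T (fun a ha => ?_) hTk)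
  have : (fun i => g i a) = σ a := by
    funext i
    have := hg i a ha
    rw [Finset.mem_filter, and_iff_right ha] at this
    exact Bool.eq_iff_iff.2 this
  simpa [this] using hT₀ _ (hσT a)

theorem comp_UTheta_subset {k : ℕ∞} {Θ K C : Set BF} (hC : C ⊆ U k) (hK : K ⊆ UTheta k Θ) :
    comp C K ⊆ UTheta k Θ := by
  classical
  rintro _ ⟨n, m, f, g, hf, hg, rfl⟩ T hT hc
  obtain ⟨i, hi⟩ := inf_ne_bot_iff.1 (hC hf (T.image fun a i => g i a) (by simpa using hT)
    (le_trans (by exact_mod_cast Finset.card_image_le) hc))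
  exact hK (hg i) T (by simpa using hi) hc

/-- A class stabilizing `K` consists of monotone functions if `K` contains functions with values
`1`, `0`, `0` at `p` and `1`, `1`, `0` at `q`, but none with value `1` at `p` and `0` at `q`. -/
theorem subset_M_of_comp_subset {C K : Set BF} (hCK : comp C K ⊆ K) {m : ℕ+} {x y z : BFun m}
    (hx : (⟨m, x⟩ : BF) ∈ K) (hy : (⟨m, y⟩ : BF) ∈ K) (hz : (⟨m, z⟩ : BF) ∈ K)
    {p q : Fin m → Bool} (hxp : x p = true) (hyp : y p = false) (hzp : z p = false)
    (hyq : y q = true) (hzq : z q = false)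
    (hK : ∀ h : BFun m, (⟨m, h⟩ : BF) ∈ K → h p = true → h q = true) : C ⊆ M := by
  rintro ⟨n, f⟩ hf u v huv
  refine bool_le_of_imp fun hu => ?_
  -- The column patterns `(1, 1)`, `(0, 1)`, `(0, 0)` of `u ≤ v` select `x`, `y`, `z`, so the inner
  -- functions evaluate to `u` at `p` and to `v` at `q`.
  have h := hK _ (hCK ⟨m, n, f, fun i => if u i = true then x else if v i = true then y else z,
    hf, fun i => by dsimp only; split_ifs <;> assumption, rfl⟩)
  have hp : (fun i => (if u i = true then x else if v i = true then y else z) p) = u := by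
    funext i
    cases hui : u i <;> cases hvi : v i <;> simp_all
  have hq : (fun i => (if u i = true then x else if v i = true then y else z) q) = v := by
    funext i
    have := fun h => bool_eq_true_of_le h (huv i)
    cases hui : u i <;> cases hvi : v i <;> simp_all
  simp only [hp, hq] at h
  exact h hu

/-! ### Closures -/

/-- The `D`-closure of `f` takes the value `1` exactly at the tuples with property `P` and at the
tuples related to true points of `f`, where `P` and the relation are preserved by minors. -/
structure ClosureDescription (D : Set BF) (P : ∀ {n : ℕ}, (Fin n → Bool) → Prop)
    (r : ∀ {n : ℕ}, (Fin n → Bool) → (Fin n → Bool) → Prop) : Prop where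
  cl_mem : ∀ {n : ℕ+} (f : BFun n), (⟨n, cl D f⟩ : BF) ∈ D
  cl_iff : ∀ {n : ℕ+} (f : BFun n) (a : Fin n → Bool),
    cl D f a = true ↔ P a ∨ ∃ b, r b a ∧ f b = true
  refl : ∀ {n : ℕ} (a : Fin n → Bool), r a a
  minor_prop : ∀ {m n : ℕ} (τ : Fin m → Fin n) (a : Fin n → Bool), P a → P (a ∘ τ)
  minor_rel : ∀ {m n : ℕ} (τ : Fin m → Fin n) (a b : Fin n → Bool), r b a → r (b ∘ τ) (a ∘ τ)

theorem closureDescription_TX1 :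
    ClosureDescription TX1 (fun a => a = ⊤) (fun b a => b = a) where
  cl_mem f := by rw [cl_eq_of_isLeast (isLeast_TX1 f)]; exact (isLeast_TX1 f).1.2
  cl_iff f a := by rw [cl_eq_of_isLeast (isLeast_TX1 f)]; simp [or_comm]
  refl _ := rfl
  minor_prop τ a h := by subst h; rfl
  minor_rel τ a b h := by rw [h]

theorem closureDescription_T1X :
    ClosureDescription T1X (fun a => a = ⊥) (fun b a => b = a) where
  cl_mem f := by rw [cl_eq_of_isLeast (isLeast_T1X f)]; exact (isLeast_T1X f).1.2
  cl_iff f a := by rw [cl_eq_of_isLeast (isLeast_T1X f)]; simp [or_comm]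
  refl _ := rfl
  minor_prop τ a h := by subst h; rfl
  minor_rel τ a b h := by rw [h]

theorem closureDescription_M :
    ClosureDescription M (fun _ => False) (fun b a => b ≤ a) where
  cl_mem f := by rw [cl_eq_of_isLeast (isLeast_M f)]; exact (isLeast_M f).1.2
  cl_iff f a := by rw [cl_eq_of_isLeast (isLeast_M f)]; simp
  refl _ := le_rfl
  minor_prop τ a h := h
  minor_rel τ a b h := fun i => h (τ i)

theorem closureDescription_negM :
    ClosureDescription (negClass M) (fun _ => False) (fun b a => a ≤ b) where
  cl_mem f := by rw [cl_eq_of_isLeast (isLeast_negM f)]; exact (isLeast_negM f).1.2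
  cl_iff f a := by rw [cl_eq_of_isLeast (isLeast_negM f)]; simp
  refl _ := le_rfl
  minor_prop τ a h := h
  minor_rel τ a b h := fun i => h (τ i)

theorem closureDescription_R :
    ClosureDescription R (fun _ => False) (fun b a => b = a ∨ b = aᶜ) where
  cl_mem f := by rw [cl_eq_of_isLeast (isLeast_R f)]; exact (isLeast_R f).1.2
  cl_iff f a := by rw [cl_eq_of_isLeast (isLeast_R f)]; simp [or_and_right, exists_or]
  refl _ := Or.inl rfl
  minor_prop τ a h := h
  minor_rel τ a b h := h.imp (fun h => by rw [h]) (fun h => by rw [h]; rfl)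

namespace ClosureDescription

variable {D : Set BF} {P : ∀ {n : ℕ}, (Fin n → Bool) → Prop}
  {r : ∀ {n : ℕ}, (Fin n → Bool) → (Fin n → Bool) → Prop} {k : ℕ∞} {Θ : Set BF}

theorem le_cl (hD : ClosureDescription D P r) {n : ℕ+} {f : BFun n} {a : Fin n → Bool}
    (h : f a = true) : cl D f a = true :=
  (hD.cl_iff f a).2 (Or.inr ⟨a, hD.refl a, h⟩)

theorem cl_mono (hD : ClosureDescription D P r) {n : ℕ+} {f g : BFun n}
    (hfg : ∀ a, f a = true → g a = true) {a : Fin n → Bool} (h : cl D f a = true) :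
    cl D g a = true :=
  (hD.cl_iff g a).2 (((hD.cl_iff f a).1 h).imp_right fun ⟨b, hb, hf⟩ => ⟨b, hb, hfg b hf⟩)

/-- Each point of `T` without `P` is related to a true point of `f`. A minor of some `θ ∈ Θ` covers
these true points, and since minors preserve `P` and `r`, the closure of `θ` covers the image of
`T`; closedness of `Θ` then puts the characteristic function of that image in `Θ`. -/
theorem cl_mem_UTheta (hD : ClosureDescription D P r)
    (hΘ : IsKClosed k D Θ) {n : ℕ+} {f : BFun n} (hf : (⟨n, f⟩ : BF) ∈ UTheta k Θ) :
    (⟨n, cl D f⟩ : BF) ∈ UTheta k Θ := by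
  classical
  intro T hT hc
  have hb : ∀ a, ∃ b : Fin n → Bool, a ∈ T → ¬ P a → r b a ∧ f b = true := by
    intro a
    by_cases ha : a ∈ T ∧ ¬ P a
    · obtain ⟨b, hb⟩ := ((hD.cl_iff f a).1 (hT a ha.1)).resolve_left ha.2
      exact ⟨b, fun _ _ => hb⟩
    · exact ⟨a, fun h1 h2 => absurd ⟨h1, h2⟩ ha⟩
  obtain ⟨b, hb⟩ := Classical.skolem.1 hb
  obtain ⟨θ, hθ, τ, hτ⟩ := hf ((T.filter fun a => ¬ P a).image b)
    (by
      simp only [Finset.mem_image, Finset.mem_filter]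
      rintro _ ⟨a, ⟨ha, hPa⟩, rfl⟩
      exact (hb a ha hPa).2)
    (le_trans (by exact_mod_cast Finset.card_image_le.trans (Finset.card_filter_le _ _)) hc)
  refine ⟨⟨θ.1, chi (T.image (· ∘ τ))⟩, hΘ θ hθ _ ?_ ?_, τ,
    fun a ha => chi_eq_true.2 (Finset.mem_image_of_mem _ ha)⟩
  · simp only [Finset.mem_image]
    rintro _ ⟨a, ha, rfl⟩
    rw [hD.cl_iff]
    by_cases hPa : P a
    · exact Or.inl (hD.minor_prop τ a hPa)
    · exact Or.inr ⟨b a ∘ τ, hD.minor_rel τ a _ (hb a ha hPa).1,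
        hτ _ (Finset.mem_image_of_mem _ (Finset.mem_filter.2 ⟨ha, hPa⟩))⟩
  · exact le_trans (by exact_mod_cast Finset.card_image_le) hc

theorem cl_chi_mem (hD : ClosureDescription D P r)
    (hΘ : IsKClosed k D Θ) {n : ℕ+} {S T : Finset (Fin n → Bool)} (hT : IsCritical Θ T)
    (hS : S ⊂ T) : (⟨n, cl D (chi S)⟩ : BF) ∈ UTheta k Θ :=
  hD.cl_mem_UTheta hΘ (chi_mem_UTheta (hT.dominated_of_ssubset S hS))

theorem cl_chi_iff (hD : ClosureDescription D P r)
    (hΘ : IsKClosed k D Θ) {n : ℕ+} {S T : Finset (Fin n → Bool)} (hTk : (T.card : ℕ∞) ≤ k)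
    (hT : IsCritical Θ T) (hS : S ⊂ T) {a : Fin n → Bool} (ha : a ∈ T) :
    cl D (chi S) a = true ↔ a ∈ S := by
  refine ⟨fun h => by_contra fun haS => ?_, fun h => hD.le_cl (chi_eq_true.2 h)⟩
  -- If the closure of `S` contained `a ∈ T \ S`, the closure of `T \ {a}` would contain all of `T`
  -- while still lying in `Uₖ(Θ)`.
  refine hT.not_dominated
    (hD.cl_chi_mem hΘ hT (Finset.erase_ssubset ha) T (fun b hb => ?_) hTk)
  by_cases hba : b = a
  · rw [hba]
    refine hD.cl_mono (fun c hc => ?_) h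
    have hcS := chi_eq_true.1 hc
    exact chi_eq_true.2 (Finset.mem_erase.2 ⟨fun e => haS (e ▸ hcS), hS.1 hcS⟩)
  · exact hD.le_cl (chi_eq_true.2 (Finset.mem_erase.2 ⟨hba, hb⟩))

theorem subset_U_of_comp_subset (hD : ClosureDescription D P r) (hΘ : IsKClosed k D Θ)
    (hk : 2 ≤ k) (hmin : IsMinimalRank k Θ) {K C : Set BF}
    (hK : ∀ (n : ℕ+) (T : Finset (Fin n → Bool)), IsCritical Θ T → ∀ S, S ⊂ T →
      (⟨n, cl D (chi S)⟩ : BF) ∈ K)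
    (hCK : comp C K ⊆ UTheta k Θ) : C ⊆ U k :=
  BoolClonoid.subset_U_of_comp_subset hk hmin (fun n T _ hTk hT S hS =>
    ⟨cl D (chi S), hK n T hT S hS, fun _ ha => hD.cl_chi_iff hΘ hTk hT hS ha⟩) hCK

end ClosureDescription

theorem IsCritical.apply_const_not {k : ℕ∞} (hk : 2 ≤ k) {Θ : Set BF} {m n : ℕ+}
    {T : Finset (Fin m → Bool)} (hT : IsCritical Θ T) {f : BFun n}
    (hf : (⟨n, f⟩ : BF) ∈ UTheta k Θ) {c : Bool} (hc : f (fun _ => c) = true) :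
    f (fun _ => !c) = false := by
  by_contra h
  rw [Bool.not_eq_false] at h
  cases c
  · exact hT.not_dominated (dominated_of_apply_bot_top hk hf hc h T)
  · exact hT.not_dominated (dominated_of_apply_bot_top hk hf h hc T)

/-! ### Functions separating the constant tuples -/

/-- The functions with value `1` at the constant tuple `c` and `0` at the other constant tuple. -/
def TConst (c : Bool) : Set BF := {f | f.2 (fun _ => !c) = false ∧ f.2 (fun _ => c) = true}

theorem T01_eq : T01 = TConst true := rfl

theorem T10_eq : T10 = TConst false := Set.ext fun _ => and_comm

section

variable {D : Set BF} {P : ∀ {n : ℕ}, (Fin n → Bool) → Prop}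
  {r : ∀ {n : ℕ}, (Fin n → Bool) → (Fin n → Bool) → Prop} {k : ℕ∞} {Θ C : Set BF} {c : Bool}

/-- A critical set with two elements has a nonempty proper subset; the closure of its characteristic
function is `1` at `c`, and cannot be `1` at both constants. -/
theorem exists_mem_UTheta_apply_const (hD : ClosureDescription D P r) (hΘ : IsKClosed k D Θ)
    (hk : 2 ≤ k) (hmin : IsMinimalRank k Θ)
    (hc : ∀ {n : ℕ+} (f : BFun n) (a : Fin n → Bool), f a = true → cl D f (fun _ => c) = true) :
    ∃ (n : ℕ+) (g : BFun n), (⟨n, g⟩ : BF) ∈ UTheta k Θ ∧ (⟨n, g⟩ : BF) ∈ D ∧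
      (⟨n, g⟩ : BF) ∈ TConst c := by
  classical
  obtain ⟨n, T, hT1, hTk, hT⟩ := exists_isCritical hmin 1 (by simpa [one_add_one_eq_two] using hk)
  obtain ⟨a, ha, b, hb, hab⟩ := Finset.one_lt_card.1 hT1
  have hg := hD.cl_chi_mem hΘ hT (Finset.erase_ssubset hb)
  have h1 := hc (chi (T.erase b)) a (chi_eq_true.2 (Finset.mem_erase.2 ⟨hab, ha⟩))
  exact ⟨n, _, hg, hD.cl_mem _, hT.apply_const_not hk hg h1, h1⟩

theorem subset_T01_of_comp_subset {K : Set BF} {n : ℕ+} {g : BFun n} (hg : (⟨n, g⟩ : BF) ∈ K)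
    (hgc : (⟨n, g⟩ : BF) ∈ TConst c) (hCK : comp C K ⊆ TConst c) : C ⊆ T01 := by
  rintro ⟨m, f⟩ hf
  obtain ⟨h0, h1⟩ := hCK ⟨n, m, f, fun _ => g, hf, fun _ => hg, rfl⟩
  have e0 : (fun _ => g fun _ => !c : Fin m → Bool) = ⊥ := funext fun _ => hgc.1
  have e1 : (fun _ => g fun _ => c : Fin m → Bool) = ⊤ := funext fun _ => hgc.2
  exact ⟨(congrArg f e0).symm.trans h0, (congrArg f e1).symm.trans h1⟩

theorem comp_TConst_subset {K : Set BF} (hC : C ⊆ T01) (hK : K ⊆ TConst c) :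
    comp C K ⊆ TConst c := by
  rintro _ ⟨n, m, f, g, hf, hg, rfl⟩
  have e0 : (fun i => g i fun _ => !c) = ⊥ := funext fun i => (hK (hg i)).1
  have e1 : (fun i => g i fun _ => c) = ⊤ := funext fun i => (hK (hg i)).2
  exact ⟨(congrArg f e0).trans (hC hf).1, (congrArg f e1).trans (hC hf).2⟩

/-- Having the constant `0` among the inner functions forces monotonicity, while having it among the
allowed values removes the condition `f(1) = 1`. -/
theorem comp_subset_iff_TConst_union (hD : ClosureDescription D P r) (hΘ : IsKClosed k D Θ)
    (hk : 2 ≤ k) (hmin : IsMinimalRank k Θ)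
    (hc : ∀ {n : ℕ+} (f : BFun n), cl D f (fun _ => c) = true) :
    comp C (UTheta k Θ ∩ (TConst c ∪ C0)) ⊆ UTheta k Θ ∩ (TConst c ∪ C0) ↔ C ⊆ MU k := by
  constructor
  · intro hCK
    obtain ⟨n₀, g₀, hg₀, -, hg₀c⟩ := exists_mem_UTheta_apply_const hD hΘ hk hmin
      (fun f _ _ => hc f)
    have hmem : ∀ {g : BFun 2}, (∀ a, g a = true → a 0 = c) →
        (⟨2, g⟩ : BF) ∈ TConst c ∪ C0 → (⟨2, g⟩ : BF) ∈ UTheta k Θ ∩ (TConst c ∪ C0) :=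
      fun hg h => ⟨mem_UTheta_of_le_proj hk hg₀ hg₀c.2 (0 : Fin 2) hg, h⟩
    refine Set.subset_inter ?_ (hD.subset_U_of_comp_subset hΘ hk hmin (fun n T hT S hS => ?_)
      (hCK.trans Set.inter_subset_left))
    -- A member of `K` that is `1` at `p` is not constant `0`, hence is `1` at `q`, the constant
    -- tuple `c`.
    · refine subset_M_of_comp_subset hCK (x := fun a => a 0 == c)
        (y := fun a => a 0 == c && a 1 == c) (z := fun _ => false)
        (hmem (fun _ h => eq_of_beq h) (Or.inl ?_))
        (hmem (fun _ h => eq_of_beq (Bool.and_eq_true_iff.1 h).1) (Or.inl ?_))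
        (hmem (by simp) (Or.inr fun _ => rfl)) (p := ![c, !c]) (q := fun _ => c)
        ?_ ?_ rfl ?_ rfl ?_
      · cases c <;> simp [TConst]
      · cases c <;> simp [TConst]
      · simp
      · cases c <;> simp
      · simp
      · rintro f ⟨-, h | h⟩ hp
        · exact h.2
        · exact absurd ((h _).symm.trans hp) Bool.false_ne_true
    · have hg := hD.cl_chi_mem hΘ hT hS
      exact ⟨hg, Or.inl ⟨hT.apply_const_not hk hg (hc _), hc _⟩⟩
  · intro hC
    refine Set.subset_inter (comp_UTheta_subset (hC.trans Set.inter_subset_right)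
      Set.inter_subset_left) ?_
    rintro _ ⟨n, m, f, g, hf, hg, rfl⟩
    have h0 : (fun i => g i (fun _ => !c)) = ⊥ := by
      funext i
      rcases (hg i).2 with h | h
      · exact h.1
      · exact h _
    -- Every inner function attains its maximum at the constant `c`; if the monotone `f` gives `0`
    -- there, the composition is constant `0`.
    cases h1 : f fun i => g i (fun _ => c)
    · refine Or.inr fun a => ?_
      by_contra ha
      refine absurd (bool_eq_true_of_le (Bool.eq_true_of_not_eq_false ha)
        ((show Monotone f from (hC hf).1) (b := fun i => g i (fun _ => c))
          fun i => bool_le_of_imp fun hi => ?_))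
        (by simpa using h1)
      rcases (hg i).2 with h | h
      · exact h.2
      · exact absurd hi (by simpa using h a)
    · refine Or.inl ⟨?_, h1⟩
      simp only [h0]
      exact apply_bot_of_mem_U hk (hC hf).2

theorem comp_subset_iff_TConst (hD : ClosureDescription D P r) (hΘ : IsKClosed k D Θ)
    (hk : 2 ≤ k) (hmin : IsMinimalRank k Θ)
    (hc : ∀ {n : ℕ+} (f : BFun n), cl D f (fun _ => c) = true) :
    comp C (UTheta k Θ ∩ TConst c) ⊆ UTheta k Θ ∩ TConst c ↔ C ⊆ T01U k := by
  constructor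
  · intro hCK
    obtain ⟨n₀, g₀, hg₀, -, hg₀c⟩ := exists_mem_UTheta_apply_const hD hΘ hk hmin
      (fun f _ _ => hc f)
    refine Set.subset_inter
      (subset_T01_of_comp_subset (K := UTheta k Θ ∩ TConst c) ⟨hg₀, hg₀c⟩ hg₀c (hCK.trans Set.inter_subset_right))
      (hD.subset_U_of_comp_subset hΘ hk hmin (fun n T hT S hS => ?_)
        (hCK.trans Set.inter_subset_left))
    have hg := hD.cl_chi_mem hΘ hT hS
    exact ⟨hg, hT.apply_const_not hk hg (hc _), hc _⟩
  · intro hC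
    exact Set.subset_inter
      (comp_UTheta_subset (hC.trans Set.inter_subset_right) Set.inter_subset_left)
      (comp_TConst_subset (hC.trans Set.inter_subset_left) Set.inter_subset_right)

end

/-! ### Monotone and antitone functions -/

/-- The functions that increase when coordinates are switched to `c`: the monotone functions for
`c = 1`, the antitone functions for `c = 0`. -/
def MDir (c : Bool) : Set BF := {f | ∀ a b, (∀ i, a i = c → b i = c) → f.2 a ≤ f.2 b}

theorem M_eq : M = MDir true := by
  ext f
  refine ⟨fun h a b hab => h fun i => bool_le_of_imp (hab i), fun h a b hab => h a b fun i hi =>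
    bool_eq_true_of_le hi (hab i)⟩

theorem negClass_M_eq : negClass M = MDir false := by
  ext ⟨n, f⟩
  rw [mem_negClass_M]
  refine ⟨fun h a b hab => h fun i => bool_le_of_imp fun hi => ?_, fun h a b hab => h b a
    fun i hi => ?_⟩
  · by_contra ha
    simp [hab i (by simpa using ha)] at hi
  · by_contra ha
    have := bool_eq_true_of_le (by simpa using ha) (hab i)
    simp [this] at hi

theorem M0_eq : M0 = MDir true ∩ {f | f.2 (fun _ => !true) = false} := by
  rw [M0, M_eq]
  rfl

theorem M01_eq : M01 = MDir true ∩ TConst true := by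
  rw [M01, M_eq, T01_eq]

theorem mem_negClass_iff {K : Set BF} {n : ℕ+} {f : BFun n} :
    (⟨n, f⟩ : BF) ∈ negClass K ↔ (⟨n, fun a => !(f a)⟩ : BF) ∈ K := by
  constructor
  · rintro ⟨⟨m, g⟩, hg, h⟩
    cases h
    simpa using hg
  · intro h
    exact ⟨_, h, by simp⟩

theorem negClass_M1_eq :
    negClass M1 = MDir false ∩ {f | f.2 (fun _ => !false) = false} := by
  rw [← negClass_M_eq]
  ext ⟨n, f⟩
  simp only [mem_negClass_iff, Set.mem_inter_iff, M1]
  refine and_congr_right fun _ => ?_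
  simp only [TX1, Set.mem_ofPred_eq, Bool.not_eq_true']
  rfl

theorem negClass_M01_eq : negClass M01 = MDir false ∩ TConst false := by
  rw [← negClass_M_eq]
  ext ⟨n, f⟩
  simp only [mem_negClass_iff, Set.mem_inter_iff, M01]
  refine and_congr_right fun _ => ?_
  simp only [T01, T0X, TX1, TConst, Set.mem_inter_iff, Set.mem_ofPred_eq, Bool.not_eq_true',
    Bool.not_eq_false', Bool.not_false]
  exact and_comm

theorem MDir.le_const {c : Bool} {n : ℕ+} {f : BFun n} (hf : (⟨n, f⟩ : BF) ∈ MDir c)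
    {a : Fin n → Bool} (ha : f a = true) : f (fun _ => c) = true :=
  bool_eq_true_of_le ha (hf a _ fun _ _ => rfl)

section

variable {P : ∀ {n : ℕ}, (Fin n → Bool) → Prop}
  {r : ∀ {n : ℕ}, (Fin n → Bool) → (Fin n → Bool) → Prop} {k : ℕ∞} {Θ C : Set BF} {c : Bool}

theorem cl_MDir_apply_const (hD : ClosureDescription (MDir c) P r) {n : ℕ+} (f : BFun n)
    (a : Fin n → Bool) (ha : f a = true) : cl (MDir c) f (fun _ => c) = true :=
  MDir.le_const (hD.cl_mem f) (hD.le_cl ha)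

theorem IsCritical.apply_const_not_of_MDir {m n : ℕ+} {T : Finset (Fin m → Bool)}
    (hT : IsCritical Θ T) (hk : 2 ≤ k) {f : BFun n} (hf : (⟨n, f⟩ : BF) ∈ UTheta k Θ)
    (hM : (⟨n, f⟩ : BF) ∈ MDir c) : f (fun _ => !c) = false := by
  by_contra h
  exact h (hT.apply_const_not hk hf (MDir.le_const hM (Bool.eq_true_of_not_eq_false h)))

theorem subset_M_of_comp_subset_MDir {n : ℕ+} {g : BFun n} (hk : 2 ≤ k)
    (hg : (⟨n, g⟩ : BF) ∈ UTheta k Θ) (hgc : g (fun _ => c) = true) {K : Set BF}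
    (hK : UTheta k Θ ∩ (MDir c ∩ TConst c) ⊆ K) (hKM : K ⊆ MDir c) (hCK : comp C K ⊆ K) :
    C ⊆ M := by
  have hmem : ∀ {f : BFun 3}, (∀ a, f a = true → a 0 = c) →
      (⟨3, f⟩ : BF) ∈ MDir c → (⟨3, f⟩ : BF) ∈ TConst c → (⟨3, f⟩ : BF) ∈ K :=
    fun hf h h' => hK ⟨mem_UTheta_of_le_proj hk hg hgc (0 : Fin 3) hf, h, h'⟩
  -- The constant `0` need not lie in `K`, so a third variable provides a `z` that vanishes at `p`
  -- and `q` but is still `1` at the constant `c`.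
  refine subset_M_of_comp_subset hCK (x := fun a => a 0 == c)
    (y := fun a => a 0 == c && a 1 == c) (z := fun a => a 0 == c && a 1 == c && a 2 == c)
    (hmem (fun _ h => eq_of_beq h) ?_ ?_)
    (hmem (fun _ h => eq_of_beq (Bool.and_eq_true_iff.1 h).1) ?_ ?_)
    (hmem (fun _ h => eq_of_beq (Bool.and_eq_true_iff.1 (Bool.and_eq_true_iff.1 h).1).1) ?_ ?_)
    (p := ![c, !c, !c]) (q := ![c, c, !c]) ?_ ?_ ?_ ?_ ?_
    (fun h hh hp => bool_eq_true_of_le hp (hKM hh _ _ ?_))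
  · intro a b hab
    exact bool_le_of_imp (by simpa using hab 0)
  · cases c <;> simp [TConst]
  · intro a b hab
    exact bool_le_of_imp (by simpa using fun h0 h1 => ⟨hab 0 h0, hab 1 h1⟩)
  · cases c <;> simp [TConst]
  · intro a b hab
    exact bool_le_of_imp (by simpa using fun h0 h1 h2 => ⟨⟨hab 0 h0, hab 1 h1⟩, hab 2 h2⟩)
  · cases c <;> simp [TConst]
  · simp
  · cases c <;> simp
  · cases c <;> simp
  · simp
  · cases c <;> simp
  · intro i
    fin_cases i <;> simp

theorem comp_MDir_subset {K : Set BF} (hC : C ⊆ M) (hK : K ⊆ MDir c) : comp C K ⊆ MDir c := by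
  rintro _ ⟨n, m, f, g, hf, hg, rfl⟩ a b hab
  exact hC hf fun i => hK (hg i) a b hab

theorem comp_subset_iff_MDir (hD : ClosureDescription (MDir c) P r)
    (hΘ : IsKClosed k (MDir c) Θ) (hk : 2 ≤ k) (hmin : IsMinimalRank k Θ) :
    comp C (UTheta k Θ ∩ (MDir c ∩ {f | f.2 (fun _ => !c) = false})) ⊆
      UTheta k Θ ∩ (MDir c ∩ {f | f.2 (fun _ => !c) = false}) ↔ C ⊆ MU k := by
  constructor
  · intro hCK
    obtain ⟨n₀, g₀, hg₀, -, hg₀c⟩ := exists_mem_UTheta_apply_const hD hΘ hk hmin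
      (cl_MDir_apply_const hD)
    refine Set.subset_inter (subset_M_of_comp_subset_MDir hk hg₀ hg₀c.2
      (K := UTheta k Θ ∩ (MDir c ∩ {f | f.2 (fun _ => !c) = false}))
      (fun f hf => ⟨hf.1, hf.2.1, hf.2.2.1⟩) (fun f hf => hf.2.1) hCK)
      (hD.subset_U_of_comp_subset hΘ hk hmin (fun n T hT S hS => ?_)
        (hCK.trans Set.inter_subset_left))
    have hg := hD.cl_chi_mem hΘ hT hS
    exact ⟨hg, hD.cl_mem _, hT.apply_const_not_of_MDir hk hg (hD.cl_mem _)⟩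
  · intro hC
    refine Set.subset_inter
      (comp_UTheta_subset (hC.trans Set.inter_subset_right) Set.inter_subset_left)
      (Set.subset_inter (comp_MDir_subset (hC.trans Set.inter_subset_left) fun f hf => hf.2.1) ?_)
    rintro _ ⟨n, m, f, g, hf, hg, rfl⟩
    have h0 : (fun i => g i (fun _ => !c)) = ⊥ := funext fun i => (hg i).2.2
    change f (fun i => g i (fun _ => !c)) = false
    rw [h0]
    exact apply_bot_of_mem_U hk (hC hf).2

theorem comp_subset_iff_MDir_TConst (hD : ClosureDescription (MDir c) P r)
    (hΘ : IsKClosed k (MDir c) Θ) (hk : 2 ≤ k) (hmin : IsMinimalRank k Θ) :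
    comp C (UTheta k Θ ∩ (MDir c ∩ TConst c)) ⊆ UTheta k Θ ∩ (MDir c ∩ TConst c) ↔
      C ⊆ M01U k := by
  constructor
  · intro hCK
    obtain ⟨n₀, g₀, hg₀, hg₀M, hg₀c⟩ := exists_mem_UTheta_apply_const hD hΘ hk hmin
      (cl_MDir_apply_const hD)
    refine Set.subset_inter (Set.subset_inter
      (subset_M_of_comp_subset_MDir hk hg₀ hg₀c.2 subset_rfl (fun f hf => hf.2.1) hCK)
      (subset_T01_of_comp_subset (K := UTheta k Θ ∩ (MDir c ∩ TConst c)) ⟨hg₀, hg₀M, hg₀c⟩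
        hg₀c (hCK.trans fun f hf => hf.2.2)))
      (subset_U_of_comp_subset hk hmin (fun n T hT1 hTk hT S hS => ?_)
        (hCK.trans Set.inter_subset_left))
    have hmem : ∀ {S : Finset (Fin n → Bool)}, S ⊂ T → S.Nonempty →
        (⟨n, cl (MDir c) (chi S)⟩ : BF) ∈ UTheta k Θ ∩ (MDir c ∩ TConst c) := by
      rintro S hS ⟨a, ha⟩
      have hg := hD.cl_chi_mem hΘ hT hS
      exact ⟨hg, hD.cl_mem _, hT.apply_const_not_of_MDir hk hg (hD.cl_mem _),
        cl_MDir_apply_const hD _ a (chi_eq_true.2 ha)⟩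
    -- The closure of the constant `0` is not `1` at `c`. For empty `S` the conjunction of the
    -- closures of two distinct singletons of `T` is used: it vanishes on `T` and is `1` at `c`.
    rcases S.eq_empty_or_nonempty with rfl | hne
    · obtain ⟨a, ha, b, hb, hab⟩ := Finset.one_lt_card.1 hT1
      have hSa : {a} ⊂ T := Finset.ssubset_iff_subset_ne.2
        ⟨by simpa using ha, fun h => by simp [← h] at hT1⟩
      have hSb : {b} ⊂ T := Finset.ssubset_iff_subset_ne.2
        ⟨by simpa using hb, fun h => by simp [← h] at hT1⟩
      have ka := hmem hSa (Finset.singleton_nonempty a)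
      have kb := hmem hSb (Finset.singleton_nonempty b)
      refine ⟨fun x => cl (MDir c) (chi {a}) x && cl (MDir c) (chi {b}) x,
        ⟨mem_UTheta_of_le ka.1 (by simp +contextual), fun x y hxy => bool_le_of_imp ?_, ?_, ?_⟩,
        fun x hx => ?_⟩
      · simp only [Bool.and_eq_true]
        exact fun h => ⟨bool_eq_true_of_le h.1 (ka.2.1 x y hxy),
          bool_eq_true_of_le h.2 (kb.2.1 x y hxy)⟩
      · exact Bool.and_eq_false_iff.2 (Or.inl ka.2.2.1)
      · exact Bool.and_eq_true_iff.2 ⟨ka.2.2.2, kb.2.2.2⟩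
      · rw [Bool.and_eq_true, hD.cl_chi_iff hΘ hTk hT hSa hx, hD.cl_chi_iff hΘ hTk hT hSb hx]
        simp only [Finset.mem_singleton, Finset.notMem_empty, iff_false, not_and]
        exact fun h h' => hab (h.symm.trans h')
    · exact ⟨_, hmem hS hne, fun x hx => hD.cl_chi_iff hΘ hTk hT hS hx⟩
  · intro hC
    exact Set.subset_inter
      (comp_UTheta_subset (hC.trans Set.inter_subset_right) Set.inter_subset_left)
      (Set.subset_inter (comp_MDir_subset (fun f hf => (hC hf).1.1) fun f hf => hf.2.1)
        (comp_TConst_subset (fun f hf => (hC hf).1.2) fun f hf => hf.2.2))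

/-! ### Arbitrary and reflexive functions -/

theorem comp_subset_iff_UTheta (hk : 2 ≤ k) (hmin : IsMinimalRank k Θ) :
    comp C (UTheta k Θ) ⊆ UTheta k Θ ↔ C ⊆ U k := by
  refine ⟨subset_U_of_comp_subset hk hmin fun n T _ _ hT S hS =>
    ⟨chi S, chi_mem_UTheta (hT.dominated_of_ssubset S hS), fun _ _ => chi_eq_true⟩,
    fun hC => comp_UTheta_subset hC subset_rfl⟩

/-- Inner functions vanish at both constants, so only `f(0) = 0` matters, which membership in `U k`
already gives. Conversely, a reflexive closure equals `1` at both constants or at neither, and the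
former is excluded by the existence of a critical set. -/
theorem comp_subset_iff_R00 (hΘ : IsKClosed k R Θ) (hk : 2 ≤ k) (hmin : IsMinimalRank k Θ) :
    comp C (UTheta k Θ ∩ R00) ⊆ UTheta k Θ ∩ R00 ↔ C ⊆ U k := by
  have hD := closureDescription_R
  constructor
  · intro hCK
    refine hD.subset_U_of_comp_subset hΘ hk hmin (fun n T hT S hS => ?_)
      (hCK.trans Set.inter_subset_left)
    have hg := hD.cl_chi_mem hΘ hT hS
    have hR : cl R (chi S) ⊥ = cl R (chi S) ⊤ := by
      simpa using (hD.cl_mem (chi S)) ⊥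
    have h0 : cl R (chi S) ⊥ = false := by
      by_contra h
      rw [Bool.not_eq_false] at h
      exact hT.not_dominated (dominated_of_apply_bot_top hk hg h (hR.symm.trans h) T)
    exact ⟨hg, hD.cl_mem _, h0, hR.symm.trans h0⟩
  · intro hC
    refine Set.subset_inter (comp_UTheta_subset hC Set.inter_subset_left) ?_
    rintro _ ⟨n, m, f, g, hf, hg, rfl⟩
    have hf0 := apply_bot_of_mem_U hk (hC hf)
    refine ⟨fun a => congrArg f (funext fun i => (hg i).2.1 a), ?_, ?_⟩
    · exact (congrArg f (funext fun i => (hg i).2.2.1)).trans hf0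
    · exact (congrArg f (funext fun i => (hg i).2.2.2)).trans hf0

end

end BoolClonoid

theorem mainTheorem5 (k : ℕ∞) (hk : 2 ≤ k) (Θ : Set BF) (hΘ : Θ ⊆ AtMost k)
    (hne : Θ.Nonempty) (hmin : IsMinimalRank k Θ) (C : Set BF) (hC : IsClone C) :
    (comp C (UTheta k Θ) ⊆ UTheta k Θ ↔ C ⊆ U k) ∧
    (IsKClosed k TX1 Θ →
      (comp C (UTheta k Θ ∩ (T01 ∪ C0)) ⊆ UTheta k Θ ∩ (T01 ∪ C0) ↔ C ⊆ MU k) ∧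
      (comp C (UTheta k Θ ∩ T01) ⊆ UTheta k Θ ∩ T01 ↔ C ⊆ T01U k)) ∧
    (IsKClosed k T1X Θ →
      (comp C (UTheta k Θ ∩ (T10 ∪ C0)) ⊆ UTheta k Θ ∩ (T10 ∪ C0) ↔ C ⊆ MU k) ∧
      (comp C (UTheta k Θ ∩ T10) ⊆ UTheta k Θ ∩ T10 ↔ C ⊆ T01U k)) ∧
    (IsKClosed k M Θ →
      (comp C (UTheta k Θ ∩ M0) ⊆ UTheta k Θ ∩ M0 ↔ C ⊆ MU k) ∧
      (comp C (UTheta k Θ ∩ M01) ⊆ UTheta k Θ ∩ M01 ↔ C ⊆ M01U k)) ∧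
    (IsKClosed k (negClass M) Θ →
      (comp C (UTheta k Θ ∩ negClass M1) ⊆ UTheta k Θ ∩ negClass M1 ↔ C ⊆ MU k) ∧
      (comp C (UTheta k Θ ∩ negClass M01) ⊆ UTheta k Θ ∩ negClass M01 ↔ C ⊆ M01U k)) ∧
    (IsKClosed k R Θ →
      (comp C (UTheta k Θ ∩ R00) ⊆ UTheta k Θ ∩ R00 ↔ C ⊆ U k)) := by

  have hTX1 := closureDescription_TX1
  have hT1X := closureDescription_T1X
  have hM := closureDescription_M
  have hN := closureDescription_negM
  rw [T01_eq, T10_eq, M0_eq, negClass_M1_eq, negClass_M01_eq, M01_eq, negClass_M_eq, M_eq]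
  rw [M_eq] at hM
  rw [negClass_M_eq] at hN
  refine ⟨comp_subset_iff_UTheta hk hmin, fun hΘ => ⟨?_, ?_⟩, fun hΘ => ⟨?_, ?_⟩,
    fun hΘ => ⟨comp_subset_iff_MDir hM hΘ hk hmin, comp_subset_iff_MDir_TConst hM hΘ hk hmin⟩,
    fun hΘ => ⟨comp_subset_iff_MDir hN hΘ hk hmin, comp_subset_iff_MDir_TConst hN hΘ hk hmin⟩,
    fun hΘ => comp_subset_iff_R00 hΘ hk hmin⟩
  · exact comp_subset_iff_TConst_union hTX1 hΘ hk hmin fun f => hTX1.cl_mem f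
  · exact comp_subset_iff_TConst hTX1 hΘ hk hmin fun f => hTX1.cl_mem f
  · exact comp_subset_iff_TConst_union hT1X hΘ hk hmin fun f => hT1X.cl_mem f
  · exact comp_subset_iff_TConst hT1X hΘ hk hmin fun f => hT1X.cl_mem f
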